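/- All graphs are finite, simple and undirected. The degree sequence of a graph on $n$ vertices is the multiset of its $n$ vertex degrees (the order of the terms is irrelevant). A graph is biconnected if it is connected and the deletion of any one vertex does not disconnect it. Let $D_0(n)$ be the set of degree sequences of graphs on $n$ vertices (zero terms allowed), $D(n)$ the set of those sequences in $D_0(n)$ all of whose terms are positive, $D_2(n)$ the set of those in $D(n)$ all of whose terms are at least $2$, $S(n)$ the set of those in $D(n)$ whose largest term is exactly $n-2$, and $D_b(n)$ the set of degree sequences of biconnected graphs on $n$ vertices. Let $p(j)$ be the number of partitions of the integer $j\ge 0$ (with $p(0)=1$). Then for every integer $n\ge 5$, $$|D_2(n)| = |D(n)|-|D_0(n-2)|-|S(n)|$$ and $$|D_b(n)| = |D_2(n)|-\sum_{i=4}^{n-1} s_i,\qquad s_i=\begin{cases}\displaystyle\sum_{0\le j\le i-4,\ j\text{ even}}p(j) & \text{if } i \text{ is even},\\[2ex] \displaystyle\sum_{1\le j\le i-4,\ j\text{ odd}}p(j) & \text{if } i\text{ is odd}.\end{cases}$$ -/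

import Mathlib

namespace DegSeq

/-- The unordered degree sequence of a finite simple graph on the vertices `0, …, n - 1`. -/
noncomputable def degrees {n : ℕ} (G : SimpleGraph (Fin n)) : Multiset ℕ :=
  open Classical in (Finset.univ : Finset (Fin n)).val.map fun v => G.degree v

/-- A graph is biconnected if it is connected and has no cut vertex: deleting any one vertex
does not disconnect it. -/
def Biconnected {V : Type*} (G : SimpleGraph V) : Prop :=
  G.Connected ∧ ∀ v : V, (G.induce {v}ᶜ).Preconnected

/-- Degree sequences of length `n`, zero terms allowed. -/
def D₀ (n : ℕ) : Set (Multiset ℕ) :=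
  {s | ∃ G : SimpleGraph (Fin n), degrees G = s}

/-- Zero-free degree sequences of length `n`. -/
def D (n : ℕ) : Set (Multiset ℕ) :=
  {s | s ∈ D₀ n ∧ ∀ d ∈ s, 1 ≤ d}

/-- Degree sequences of length `n` whose smallest term is at least `2`. -/
def D₂ (n : ℕ) : Set (Multiset ℕ) :=
  {s | s ∈ D n ∧ ∀ d ∈ s, 2 ≤ d}

/-- Zero-free degree sequences of length `n` whose largest term is exactly `n - 2`
(for `n ≥ 2`). -/
def S (n : ℕ) : Set (Multiset ℕ) :=
  {s | s ∈ D n ∧ IsGreatest {d | d ∈ s} (n - 2)}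

/-- Degree sequences of biconnected graphs on `n` vertices. -/
def Db (n : ℕ) : Set (Multiset ℕ) :=
  {s | ∃ G : SimpleGraph (Fin n), Biconnected G ∧ degrees G = s}

/-- The partition function. -/
def p (j : ℕ) : ℕ := Fintype.card (Nat.Partition j)

/-- All the sets above are finite, so that `Set.ncard` is their true cardinality. -/
theorem finite_sets (n : ℕ) :
    (D₀ n).Finite ∧ (D n).Finite ∧ (D₂ n).Finite ∧ (S n).Finite ∧ (Db n).Finite := by
  have h : (D₀ n).Finite := Set.finite_range (degrees (n := n))
  exact ⟨h, h.subset fun _ hs => hs.1, h.subset fun _ hs => hs.1.1,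
    h.subset fun _ hs => hs.1.1, h.subset fun _ ⟨G, hG⟩ => ⟨G, hG.2⟩⟩

end DegSeq

/-! For the first identity, a zero-free sequence outside `D₂ n` contains a 1. If it also contains `n
- 1`, deleting the dominating vertex and then the vertex this isolates gives a bijection with `D₀ (n
- 2)`. Otherwise complementation turns the 1 into a largest term `n - 2`, giving a bijection with `S
n`.

The second identity rests on `mem_Db_iff`: a sequence in `D₂ n` is biconnected exactly when every
term `i` leaves at least `n - 2` edges after deletion of its vertex. Necessity counts the edges of a
connected graph on `n - 1` vertices. For sufficiency, take a realization with the most pairs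
connected in its vertex-deleted subgraphs. If `G - v` were disconnected, the edge count would force
a cycle in one component, and minimum degree 2 forces a cycle in another component together with
`v`. Swapping an edge of one cycle with an edge of the other preserves degrees and all these
connections, and creates a new one (`exists_swap`).

A sequence violating the inequality has a term `i` whose companions, reduced by 2, sum to some `j ≤
i - 4` of the parity of `i`: a partition of `j` padded by zeros. Each such sequence is realized by
joining a hub to `i` vertices of a forest (`hubSeq_mem_D₀`). -/

namespace DegSeq

open SimpleGraph

/-! ### Edge swaps and cycles from longest paths. -/

section Swap

variable {V : Type*}

/-- Reachability is inherited if every edge of the first graph joins reachable vertices of the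
second. -/
theorem reachable_of_forall_adj {G H : SimpleGraph V}
    (h : ∀ x y, G.Adj x y → H.Reachable x y) {x y : V} (hxy : G.Reachable x y) :
    H.Reachable x y := by
  obtain ⟨w⟩ := hxy
  induction w with
  | nil => rfl
  | cons hadj _ ih => exact (h _ _ hadj).trans ih

/-- The graph on the same vertices whose edges are the edges of `G` inside `s`, except `e`. -/
def insideMinus (G : SimpleGraph V) (s : Set V) (e : Sym2 V) : SimpleGraph V where
  Adj x y := G.Adj x y ∧ x ∈ s ∧ y ∈ s ∧ s(x, y) ≠ e
  symm := ⟨fun x y h => ⟨h.1.symm, h.2.2.1, h.2.1, by rw [Sym2.eq_swap]; exact h.2.2.2⟩⟩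
  loopless := ⟨fun x h => G.loopless.irrefl x h.1⟩

/-- Replace the edges `ab`, `cd` by `ac`, `bd`. -/
def swap (G : SimpleGraph V) (a b c d : V) : SimpleGraph V :=
  (G.deleteEdges {s(a, b), s(c, d)}) ⊔ edge a c ⊔ edge b d

theorem swap_adj {G : SimpleGraph V} {a b c d x y : V} (hac : a ≠ c) (hbd : b ≠ d) :
    (swap G a b c d).Adj x y ↔
      (G.Adj x y ∧ s(x, y) ≠ s(a, b) ∧ s(x, y) ≠ s(c, d)) ∨ s(x, y) = s(a, c) ∨
        s(x, y) = s(b, d) := by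
  simp only [swap, sup_adj, deleteEdges_adj, edge_adj, Set.mem_insert_iff,
    Set.mem_singleton_iff, Sym2.eq_iff]
  constructor
  · grind
  · rintro (h | h | h)
    · grind
    · left; right; grind
    · right; grind

theorem swap_comm {G : SimpleGraph V} {a b c d : V} : swap G b a d c = swap G a b c d := by
  unfold swap
  rw [Sym2.eq_swap (a := b), Sym2.eq_swap (a := d), sup_assoc, sup_comm (edge b d), ← sup_assoc]

theorem swap_comm' {G : SimpleGraph V} {a b c d : V} : swap G c d a b = swap G a b c d := by
  unfold swap
  rw [Set.pair_comm, edge_comm c, edge_comm d]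

open Classical in
theorem degree_swap_left [Fintype V] {G : SimpleGraph V} {a b c d : V} (hab : G.Adj a b)
    (hac : a ≠ c) (had : a ≠ d) (hbd : b ≠ d) (nac : ¬ G.Adj a c) :
    (swap G a b c d).degree a = G.degree a := by
  have h : (swap G a b c d).neighborFinset a = insert c ((G.neighborFinset a).erase b) := by
    ext y
    simp only [mem_neighborFinset, swap_adj hac hbd, Finset.mem_insert, Finset.mem_erase,
      Sym2.eq_iff]
    have := hab.ne
    grind
  rw [← card_neighborFinset_eq_degree, ← card_neighborFinset_eq_degree, h,
    Finset.card_insert_of_notMem (by simp [nac]), Finset.card_erase_of_mem (by simpa using hab)]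
  have : 0 < (G.neighborFinset a).card := Finset.card_pos.2 ⟨b, by simpa using hab⟩
  omega

-- The symmetries `swap_comm` and `swap_comm'` move any of the four endpoints into the position of
-- `a`, so `degree_swap_left` covers them all.
open Classical in
theorem degree_swap [Fintype V] {G : SimpleGraph V} {a b c d : V} (hab : G.Adj a b)
    (hcd : G.Adj c d)
    (hac : a ≠ c) (had : a ≠ d) (hbc : b ≠ c) (hbd : b ≠ d) (nac : ¬ G.Adj a c)
    (nbd : ¬ G.Adj b d) (x : V) :
    (swap G a b c d).degree x = G.degree x := by
  by_cases hxa : x = a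
  · subst hxa; exact degree_swap_left hab hac had hbd nac
  by_cases hxb : x = b
  · subst hxb
    rw [← swap_comm]
    exact degree_swap_left hab.symm hbd hbc hac nbd
  by_cases hxc : x = c
  · subst hxc
    rw [← swap_comm']
    exact degree_swap_left hcd hac.symm hbc.symm hbd.symm (fun h => nac h.symm)
  by_cases hxd : x = d
  · subst hxd
    rw [← swap_comm', ← swap_comm]
    exact degree_swap_left hcd.symm hbd.symm had.symm hac.symm
      (fun h => nbd h.symm)
  rw [← card_neighborFinset_eq_degree, ← card_neighborFinset_eq_degree]
  congr 1
  ext y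
  simp only [mem_neighborFinset, swap_adj hac hbd, Sym2.eq_iff]
  grind

/-- An edge swap between two disjoint sets, in each of which the removed edge can be bypassed,
does not destroy reachability in any vertex-deleted subgraph. -/
theorem reachable_swap {G : SimpleGraph V} {A B : Set V} (hAB : Disjoint A B) {a b c d : V}
    (ha : a ∈ A) (hb : b ∈ A) (hc : c ∈ B) (hd : d ∈ B)
    (hA : (insideMinus G A s(a, b)).Reachable a b)
    (hB : (insideMinus G B s(c, d)).Reachable c d)
    (u : V) {x y : V} (h : (G.deleteIncidenceSet u).Reachable x y) :
    ((swap G a b c d).deleteIncidenceSet u).Reachable x y := by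
  have dj : ∀ z, z ∈ A → z ∉ B := fun z h h' => Set.disjoint_left.1 hAB h h'
  have hac : a ≠ c := fun h => dj a ha (h ▸ hc)
  have hbd : b ≠ d := fun h => dj b hb (h ▸ hd)
  set K := (swap G a b c d).deleteIncidenceSet u with hK
  have hadj : ∀ x y, K.Adj x y ↔ (((G.Adj x y ∧ s(x, y) ≠ s(a, b) ∧ s(x, y) ≠ s(c, d)) ∨
      s(x, y) = s(a, c) ∨ s(x, y) = s(b, d)) ∧ x ≠ u ∧ y ≠ u) := fun x y => by
    rw [hK, deleteIncidenceSet_adj, swap_adj hac hbd]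
  have kA : u ∉ A → K.Reachable a b := fun hu => hA.mono fun x y hxy => by
    rw [hadj]
    obtain ⟨h1, h2, h3, h4⟩ := hxy
    refine ⟨.inl ⟨h1, h4, ?_⟩, ?_, ?_⟩
    · rw [Ne, Sym2.eq_iff]; grind
    · grind
    · grind
  have kB : u ∉ B → K.Reachable c d := fun hu => hB.mono fun x y hxy => by
    rw [hadj]
    obtain ⟨h1, h2, h3, h4⟩ := hxy
    refine ⟨.inl ⟨h1, ?_, h4⟩, ?_, ?_⟩
    · rw [Ne, Sym2.eq_iff]; grind
    · grind
    · grind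
  have kac : a ≠ u → c ≠ u → K.Reachable a c := fun h1 h2 =>
    Adj.reachable ((hadj _ _).2 ⟨.inr (.inl rfl), h1, h2⟩)
  have kbd : b ≠ u → d ≠ u → K.Reachable b d := fun h1 h2 =>
    Adj.reachable ((hadj _ _).2 ⟨.inr (.inr rfl), h1, h2⟩)
  -- Only one of `A`, `B` can contain `u`. If it is `A`, the bypass there may be cut, but the new
  -- edges `ac`, `bd` and the bypass in `B` lead from `a` to `b`.
  have rab : a ≠ u → b ≠ u → K.Reachable a b := fun h1 h2 => by
    by_cases hu : u ∈ A
    · have hu' := dj u hu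
      exact (kac h1 (by grind)).trans ((kB hu').trans (kbd h2 (by grind)).symm)
    · exact kA hu
  have rcd : c ≠ u → d ≠ u → K.Reachable c d := fun h1 h2 => by
    by_cases hu : u ∈ A
    · exact kB (dj u hu)
    · exact (kac (by grind) h1).symm.trans ((kA hu).trans (kbd (by grind) h2))
  refine reachable_of_forall_adj (fun x y hxy => ?_) h
  rw [deleteIncidenceSet_adj] at hxy
  obtain ⟨hxy, hx, hy⟩ := hxy
  by_cases e1 : s(x, y) = s(a, b)
  · rcases Sym2.eq_iff.1 e1 with ⟨rfl, rfl⟩ | ⟨rfl, rfl⟩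
    · exact rab hx hy
    · exact (rab hy hx).symm
  by_cases e2 : s(x, y) = s(c, d)
  · rcases Sym2.eq_iff.1 e2 with ⟨rfl, rfl⟩ | ⟨rfl, rfl⟩
    · exact rcd hx hy
    · exact (rcd hy hx).symm
  exact Adj.reachable ((hadj _ _).2 ⟨.inl ⟨hxy, e1, e2⟩, hx, hy⟩)

/-- A finite graph with an edge in which every vertex other than `v` that has a neighbour has a
second one contains a cycle through a vertex `w ≠ v`. -/
theorem exists_cycle_vertex_ne [Finite V] {H : SimpleGraph V} {v : V}
    (hdeg : ∀ w y, w ≠ v → H.Adj w y → ∃ t, t ≠ y ∧ H.Adj w t) {x₀ y₀ : V} (h₀ : H.Adj x₀ y₀) :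
    ∃ w y t, w ≠ v ∧ y ≠ t ∧ H.Adj w y ∧ H.Adj w t ∧ (H.deleteIncidenceSet w).Reachable y t := by
  classical
  have := Fintype.ofFinite V
  have : Nonempty V := ⟨v⟩
  -- By maximality, every neighbour of an end of a longest path lies on the path, so a second
  -- neighbour of that end closes a cycle.
  obtain ⟨w, z, p, hp, hmax⟩ := Walk.exists_isPath_forall_isPath_length_le_length H
  have hpos : 1 ≤ p.length := by
    have := hmax x₀ y₀ (.cons h₀ .nil) (by simpa using h₀.ne)
    simpa using this
  have key : ∀ (w z : V) (p : H.Walk w z), p.IsPath → 1 ≤ p.length → w ≠ v →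
      (∀ (u' v' : V) (p' : H.Walk u' v'), p'.IsPath → p'.length ≤ p.length) →
      ∃ w y t, w ≠ v ∧ y ≠ t ∧ H.Adj w y ∧ H.Adj w t ∧
        (H.deleteIncidenceSet w).Reachable y t := by
    intro w z p hp hpos hw hmax
    cases p with
    | nil => simp at hpos
    | @cons _ y _ hwy q =>
      rw [Walk.cons_isPath_iff] at hp
      obtain ⟨t, hty, hwt⟩ := hdeg w y hw hwy
      have htq : t ∈ q.support := by
        by_contra hcon
        have := hmax t z (.cons hwt.symm (.cons hwy q)) (by
          rw [Walk.cons_isPath_iff, Walk.cons_isPath_iff]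
          refine ⟨hp, ?_⟩
          simp [hcon, hwt.ne.symm])
        simp at this
      refine ⟨w, y, t, hw, hty.symm, hwy, hwt, ?_⟩
      have hwq : w ∉ (q.takeUntil t htq).support := fun h =>
        hp.2 (q.support_takeUntil_subset_support htq h)
      refine ⟨(q.takeUntil t htq).transfer _ fun e he => ?_⟩
      have heG := (q.takeUntil t htq).edges_subset_edgeSet he
      rw [edgeSet_deleteIncidenceSet]
      refine ⟨heG, fun hinc => hwq ?_⟩
      have : w ∈ e := hinc.2
      exact Walk.mem_support_of_mem_edges he this
  -- The path has two distinct ends, so one of them differs from `v`.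
  by_cases hw : w = v
  · have hz : z ≠ v := by
      rintro rfl
      subst hw
      rw [Walk.isPath_iff_nil, ← Walk.length_eq_zero_iff] at hp
      omega
    exact key z w p.reverse hp.reverse (by simpa using hpos) hz (by simpa using hmax)
  · exact key w z p hp hpos hw hmax

end Swap

/-! ### Improving vertex-deleted connectivity by swaps. -/

section Biconnected

variable {V : Type*}

/-- `deleteIncidenceSet` keeps `v` as an isolated vertex, so that all the graphs compared share one
vertex type. -/
theorem not_reachable_deleteIncidenceSet {G : SimpleGraph V} {v x : V} (hx : x ≠ v) :
    ¬ (G.deleteIncidenceSet v).Reachable v x := by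
  rintro ⟨w⟩
  cases w with
  | nil => exact hx rfl
  | cons h _ => exact (deleteIncidenceSet_adj.1 h).2.1 rfl

open Classical in
theorem IsAcyclic.card_edgeFinset_lt [Fintype V] [Nonempty V] {G : SimpleGraph V}
    (hG : G.IsAcyclic) : G.edgeFinset.card + 1 ≤ Fintype.card V := by
  obtain ⟨T, hGT, -, hT⟩ :=
    (connected_top (V := V)).exists_isTree_le_of_le_of_isAcyclic le_top hG
  rw [← hT.card_edgeFinset]
  exact Nat.succ_le_succ (Finset.card_le_card (edgeFinset_mono hGT))

open Classical in
/-- If deleting `v` disconnects the graph but leaves many edges, one of these is not a bridge. -/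
theorem exists_not_isBridge [Fintype V] {G : SimpleGraph V} {v x y : V} (hx : x ≠ v) (hy : y ≠ v)
    (hxy : ¬ (G.deleteIncidenceSet v).Reachable x y)
    (hcard : Fintype.card V ≤ (G.deleteIncidenceSet v).edgeFinset.card + 2) :
    ∃ a b, (G.deleteIncidenceSet v).Adj a b ∧ ¬ (G.deleteIncidenceSet v).IsBridge s(a, b) := by
  by_contra! hcon
  have hac : (G.deleteIncidenceSet v).IsAcyclic :=
    isAcyclic_iff_forall_adj_isBridge.2 fun a b h => hcon a b h
  set H := G.deleteIncidenceSet v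
  -- `x`, `y` and the isolated `v` lie in three different components, so two edges can be added to a
  -- forest `H`; it would then have at least as many edges as vertices.
  have h1 : (H ⊔ edge x y).IsAcyclic := hac.sup_edge_of_not_reachable hxy
  have n1 : ¬ (H ⊔ edge x y).Reachable v x := by
    rintro ⟨w⟩
    cases w with
    | nil => exact hx rfl
    | cons h _ =>
      rw [sup_adj, deleteIncidenceSet_adj, edge_adj] at h
      grind
  have h2 := h1.sup_edge_of_not_reachable n1
  have : Nonempty V := ⟨v⟩
  have h3 := IsAcyclic.card_edgeFinset_lt h2
  have e1 := card_edgeFinset_sup_edge (H ⊔ edge x y) (fun h => n1 h.reachable) hx.symm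
  have e2 := card_edgeFinset_sup_edge H (fun h => hxy h.reachable)
    (fun h => hxy (h ▸ Reachable.refl _))
  simp only [edgeFinset_card, ← Nat.card_eq_fintype_card] at e1 e2 h3 hcard
  change _ ≤ Nat.card H.edgeSet + 2 at hcard
  omega

/-- A walk stays inside the component of its start. -/
theorem reachable_insideMinus {G : SimpleGraph V} {v a b : V}
    (h : ((G.deleteIncidenceSet v).deleteEdges {s(a, b)}).Reachable a b) :
    (insideMinus G {x | (G.deleteIncidenceSet v).Reachable a x} s(a, b)).Reachable a b := by
  obtain ⟨w⟩ := h
  suffices ∀ x y (w : ((G.deleteIncidenceSet v).deleteEdges {s(a, b)}).Walk x y),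
      (G.deleteIncidenceSet v).Reachable a x →
      (insideMinus G {x | (G.deleteIncidenceSet v).Reachable a x} s(a, b)).Reachable x y from
    this a b w (Reachable.refl _)
  intro x y w
  induction w with
  | nil => intro; rfl
  | @cons x z y hxz w ih =>
    intro hx
    rw [deleteEdges_adj] at hxz
    have hz := hx.trans hxz.1.reachable
    refine (Adj.reachable ?_).trans (ih hz)
    exact ⟨(deleteIncidenceSet_adj.1 hxz.1).1, hx, hz, hxz.2⟩

/-- In the component `C` of `z` in `G - v`, there is an edge of `G` on a cycle inside
`C ∪ {v}`. -/
theorem exists_bypassed_edge [Finite V] {G : SimpleGraph V}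
    (hdeg : ∀ w y, G.Adj w y → ∃ t, t ≠ y ∧ G.Adj w t) (hne : ∀ w, ∃ y, G.Adj w y)
    {v z : V} (hz : z ≠ v) :
    ∃ c d, (G.deleteIncidenceSet v).Reachable z c ∧ (G.deleteIncidenceSet v).Reachable z d ∧
      G.Adj c d ∧
      (insideMinus G (insert v {x | (G.deleteIncidenceSet v).Reachable z x}) s(c, d)).Reachable
        c d := by
  set C : Set V := {x | (G.deleteIncidenceSet v).Reachable z x} with hC
  have hvC : v ∉ C := fun h => not_reachable_deleteIncidenceSet hz h.symm
  have hclosed : ∀ x y, x ∈ C → G.Adj x y → y ∈ insert v C := fun x y hx hxy => by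
    by_cases hy : y = v
    · exact .inl hy
    · right
      have hxv : x ≠ v := fun h => hvC (h ▸ hx)
      exact Reachable.trans hx (Adj.reachable (deleteIncidenceSet_adj.2 ⟨hxy, hxv, hy⟩))
  -- Vertices of `C` keep all their neighbours in `H`; only `v` may lose some, hence the exceptional
  -- vertex in `exists_cycle_vertex_ne`.
  let H : SimpleGraph V :=
    { Adj := fun x y => G.Adj x y ∧ x ∈ insert v C ∧ y ∈ insert v C
      symm := ⟨fun x y h => ⟨h.1.symm, h.2.2, h.2.1⟩⟩
      loopless := ⟨fun x h => G.loopless.irrefl x h.1⟩ }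
  have hzC : z ∈ C := Reachable.refl _
  obtain ⟨y₀, hy₀⟩ := hne z
  have h₀ : H.Adj z y₀ := ⟨hy₀, .inr hzC, hclosed _ _ hzC hy₀⟩
  have hmem : ∀ w y, w ≠ v → H.Adj w y → w ∈ C := fun w y hw h => h.2.1.resolve_left hw
  obtain ⟨w, y, t, hwv, hyt, hwy, hwt, hr⟩ := exists_cycle_vertex_ne (H := H) (v := v)
    (fun w y hw h => by
      obtain ⟨t, ht, hwt⟩ := hdeg w y h.1
      exact ⟨t, ht, hwt, h.2.1, hclosed _ _ (hmem w y hw h) hwt⟩) h₀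
  -- At most one of the two cycle neighbours of `w` is `v`; the edge to the other one has both ends
  -- in `C`.
  have key : ∀ y t, y ≠ t → H.Adj w y → H.Adj w t → (H.deleteIncidenceSet w).Reachable y t →
      y ≠ v → ∃ c d, c ∈ C ∧ d ∈ C ∧ G.Adj c d ∧
        (insideMinus G (insert v C) s(c, d)).Reachable c d := by
    intro y t hyt hwy hwt hr hy
    refine ⟨w, y, hmem w y hwv hwy, hwy.2.2.resolve_left hy, hwy.1, ?_⟩
    have e1 : (insideMinus G (insert v C) s(w, y)).Adj w t :=
      ⟨hwt.1, hwt.2.1, hwt.2.2, by rw [Ne, Sym2.eq_iff]; have := hwt.1.ne; grind⟩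
    refine e1.reachable.trans (hr.symm.mono fun p q hpq => ?_)
    obtain ⟨h1, h2, h3⟩ := deleteIncidenceSet_adj.1 hpq
    exact ⟨h1.1, h1.2.1, h1.2.2, by rw [Ne, Sym2.eq_iff]; grind⟩
  by_cases hy : y = v
  · exact key t y hyt.symm hwt hwy hr.symm (fun h => hyt (hy.trans h.symm))
  · exact key y t hyt hwy hwt hr hy

open Classical in
/-- A graph with minimum degree at least two and enough edges either has only connected
vertex-deleted subgraphs, or an edge swap makes these strictly better connected. -/
theorem exists_swap [Fintype V] {G : SimpleGraph V} (hdeg : ∀ x, 2 ≤ G.degree x) {v : V}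
    (hcard : Fintype.card V ≤ (G.deleteIncidenceSet v).edgeFinset.card + 2)
    {x y : V} (hx : x ≠ v) (hy : y ≠ v) (hxy : ¬ (G.deleteIncidenceSet v).Reachable x y) :
    ∃ G' : SimpleGraph V, (∀ z, G'.degree z = G.degree z) ∧
      (∀ u p q, (G.deleteIncidenceSet u).Reachable p q →
        (G'.deleteIncidenceSet u).Reachable p q) ∧
      ∃ p q, (G'.deleteIncidenceSet v).Reachable p q ∧
        ¬ (G.deleteIncidenceSet v).Reachable p q := by
  obtain ⟨a, b, hab, hbr⟩ := exists_not_isBridge hx hy hxy hcard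
  rw [isBridge_iff, not_not] at hbr
  obtain ⟨z, hz, haz⟩ : ∃ z, z ≠ v ∧ ¬ (G.deleteIncidenceSet v).Reachable a z := by
    by_contra! hcon
    exact hxy ((hcon x hx).symm.trans (hcon y hy))
  have hne : ∀ w, ∃ y, G.Adj w y := fun w => by
    have := hdeg w
    exact (G.degree_pos_iff_exists_adj w).1 (by omega)
  have hdeg' : ∀ w y, G.Adj w y → ∃ t, t ≠ y ∧ G.Adj w t := fun w y _ => by
    have := hdeg w
    rw [← card_neighborFinset_eq_degree] at this
    obtain ⟨t, ht, hty⟩ := Finset.exists_mem_ne (s := G.neighborFinset w) (by omega) y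
    exact ⟨t, hty, by simpa using ht⟩
  obtain ⟨c, d, hzc, hzd, hcd, hB⟩ := exists_bypassed_edge hdeg' hne hz
  have hA := reachable_insideMinus hbr
  have hav : a ≠ v := (deleteIncidenceSet_adj.1 hab).2.1
  have hcv : c ≠ v := fun h => not_reachable_deleteIncidenceSet hz (h ▸ hzc).symm
  have hdv : d ≠ v := fun h => not_reachable_deleteIncidenceSet hz (h ▸ hzd).symm
  have hbv : b ≠ v := (deleteIncidenceSet_adj.1 hab).2.2
  have nr : ∀ p q, (G.deleteIncidenceSet v).Reachable a p →
      (G.deleteIncidenceSet v).Reachable z q → ¬ (G.deleteIncidenceSet v).Reachable p q :=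
    fun p q hp hq h => haz (hp.trans (h.trans hq.symm))
  have ra : (G.deleteIncidenceSet v).Reachable a a := Reachable.refl _
  have rb : (G.deleteIncidenceSet v).Reachable a b := hab.reachable
  have ne : ∀ p q, (G.deleteIncidenceSet v).Reachable a p →
      (G.deleteIncidenceSet v).Reachable z q → p ≠ q :=
    fun p q hp hq h => nr p q hp hq (h ▸ Reachable.refl _)
  have nadj : ∀ p q, p ≠ v → q ≠ v → ¬ (G.deleteIncidenceSet v).Reachable p q → ¬ G.Adj p q :=
    fun p q hp hq h h' => h (Adj.reachable (deleteIncidenceSet_adj.2 ⟨h', hp, hq⟩))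
  refine ⟨swap G a b c d, ?_, ?_, a, c, ?_, nr a c ra hzc⟩
  · exact degree_swap (deleteIncidenceSet_adj.1 hab).1 hcd (ne _ _ ra hzc) (ne _ _ ra hzd)
      (ne _ _ rb hzc) (ne _ _ rb hzd) (nadj _ _ hav hcv (nr _ _ ra hzc))
      (nadj _ _ hbv hdv (nr _ _ rb hzd))
  · intro u p q h
    refine reachable_swap
      (A := {x | (G.deleteIncidenceSet v).Reachable a x})
      (B := insert v {x | (G.deleteIncidenceSet v).Reachable z x})
      ?_ ra rb (.inr hzc) (.inr hzd) hA hB u h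
    rw [Set.disjoint_left]
    rintro p hp (rfl | hq)
    · exact not_reachable_deleteIncidenceSet hav (Reachable.symm hp)
    · exact ne p p hp hq rfl
  · exact Adj.reachable (deleteIncidenceSet_adj.2
      ⟨(swap_adj (ne _ _ ra hzc) (ne _ _ rb hzd)).2 (.inr (.inl rfl)), hav, hcv⟩)

open Classical in
/-- A graph with minimum degree at least two and enough edges outside every vertex has the same
degrees as one whose vertex-deleted subgraphs are all connected. -/
theorem exists_reachable_deleteIncidenceSet [Fintype V] (G₀ : SimpleGraph V)
    (hdeg : ∀ x, 2 ≤ G₀.degree x)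
    (hcard : ∀ v, Fintype.card V + G₀.degree v ≤ G₀.edgeFinset.card + 2) :
    ∃ G : SimpleGraph V, (∀ z, G.degree z = G₀.degree z) ∧
      ∀ v x y, x ≠ v → y ≠ v → (G.deleteIncidenceSet v).Reachable x y := by
  -- The potential counts triples `(u, p, q)` with `p`, `q` connected after the edges at `u` are
  -- removed; a swap from `exists_swap` strictly increases it.
  let f : SimpleGraph V → ℕ := fun G => (Finset.univ.filter fun t : V × V × V =>
    (G.deleteIncidenceSet t.1).Reachable t.2.1 t.2.2).card
  obtain ⟨G, hG, hmax⟩ := Finset.exists_max_image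
    (Finset.univ.filter fun G : SimpleGraph V => ∀ z, G.degree z = G₀.degree z) f ⟨G₀, by simp⟩
  rw [Finset.mem_filter] at hG
  refine ⟨G, hG.2, fun v x y hx hy => ?_⟩
  by_contra hxy
  have he : G.edgeFinset.card = G₀.edgeFinset.card := by
    have h1 := G.sum_degrees_eq_twice_card_edges
    have h2 := G₀.sum_degrees_eq_twice_card_edges
    rw [Finset.sum_congr rfl fun z _ => hG.2 z] at h1
    omega
  have hc : Fintype.card V ≤ (G.deleteIncidenceSet v).edgeFinset.card + 2 := by
    have := card_edgeFinset_deleteIncidenceSet G v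
    have h2 := hcard v
    rw [← hG.2 v, ← he] at h2
    have h3 : G.degree v ≤ G.edgeFinset.card := degree_le_card_edgeFinset G v
    convert (show Fintype.card V ≤ G.edgeFinset.card - G.degree v + 2 by omega) using 2
  obtain ⟨G', hd, hr, p, q, hpq, hnpq⟩ :=
    exists_swap (fun z => (hdeg z).trans_eq (hG.2 z).symm) hc hx hy hxy
  have hle := hmax G' (by simp [hd, hG.2])
  refine absurd hle (not_le.2 (Finset.card_lt_card ?_))
  rw [Finset.ssubset_iff_of_subset]
  · exact ⟨(v, p, q), by simpa using hpq, by simpa using hnpq⟩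
  · rintro ⟨u, r, s⟩ h
    simp only [Finset.mem_filter, Finset.mem_univ, true_and] at h ⊢
    exact hr u r s h

end Biconnected

/-! ### Operations on degree sequences, and realization of sequences with small sum. -/

section Sequences

open Classical in
theorem mem_degrees {n : ℕ} {G : SimpleGraph (Fin n)} {d : ℕ} :
    d ∈ degrees G ↔ ∃ v, G.degree v = d := by
  simp [degrees]

theorem card_degrees {n : ℕ} (G : SimpleGraph (Fin n)) : (degrees G).card = n := by
  simp [degrees]

open Classical in
theorem sum_degrees {n : ℕ} (G : SimpleGraph (Fin n)) :
    (degrees G).sum = 2 * G.edgeFinset.card := by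
  rw [← sum_degrees_eq_twice_card_edges]
  rfl

theorem card_of_mem_D₀ {n : ℕ} {s : Multiset ℕ} (hs : s ∈ D₀ n) : s.card = n := by
  obtain ⟨G, rfl⟩ := hs
  exact card_degrees G

theorem even_sum_of_mem_D₀ {n : ℕ} {s : Multiset ℕ} (hs : s ∈ D₀ n) : Even s.sum := by
  classical
  obtain ⟨G, rfl⟩ := hs
  rw [sum_degrees]
  exact even_two_mul _

theorem lt_of_mem_D₀ {n : ℕ} {s : Multiset ℕ} (hs : s ∈ D₀ n) {d : ℕ} (hd : d ∈ s) : d < n := by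
  classical
  obtain ⟨G, rfl⟩ := hs
  obtain ⟨v, rfl⟩ := mem_degrees.1 hd
  simpa using G.degree_lt_card_verts v

open Classical in
theorem degree_eq_sum {V : Type*} [Fintype V] (G : SimpleGraph V) (v : V) :
    G.degree v = ∑ w, if G.Adj v w then 1 else 0 := by
  rw [← card_neighborFinset_eq_degree, neighborFinset_eq_filter, Finset.card_filter]

open Classical in
/-- The degrees of a graph in terms of those of the graph with `v` deleted. -/
theorem degrees_eq_cons {N : ℕ} (G : SimpleGraph (Fin (N + 1))) (v : Fin (N + 1))
    (G' : SimpleGraph (Fin N)) (hG' : G' = G.comap v.succAbove) :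
    degrees G = G.degree v ::ₘ (Finset.univ : Finset (Fin N)).val.map fun w =>
      G'.degree w + if G.Adj v (v.succAbove w) then 1 else 0 := by
  unfold degrees
  rw [Fin.univ_succAbove N v, Finset.cons_val, Multiset.map_cons, Finset.map_val,
    Multiset.map_map]
  congr 1
  refine Multiset.map_congr rfl fun w _ => ?_
  simp only [Function.comp_apply, Fin.coe_succAboveEmb]
  rw [degree_eq_sum, degree_eq_sum, Fin.sum_univ_succAbove _ v, add_comm]
  simp only [hG', comap_adj, adj_comm]

theorem exists_split_of_map_eq_add {α β : Type*} (f : α → β) (s₁ s₂ : Multiset β) :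
    ∀ M : Multiset α, M.map f = s₁ + s₂ →
      ∃ M₁ M₂, M = M₁ + M₂ ∧ M₁.map f = s₁ ∧ M₂.map f = s₂ := by
  induction s₁ using Multiset.induction_on with
  | empty => exact fun M h => ⟨0, M, by simpa using h⟩
  | cons a s ih =>
    intro M h
    rcases Multiset.mem_map.1 (show a ∈ M.map f by rw [h]; simp) with ⟨x, hx, rfl⟩
    obtain ⟨M', rfl⟩ := Multiset.exists_cons_of_mem hx
    rw [Multiset.map_cons, Multiset.cons_add, Multiset.cons_inj_right] at h
    obtain ⟨M₁, M₂, rfl, rfl, rfl⟩ := ih M' h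
    exact ⟨x ::ₘ M₁, M₂, by simp, by simp, rfl⟩

/-- Add to `G` a new vertex `0` adjacent to the vertices in `T`. -/
def addVertex {N : ℕ} (G : SimpleGraph (Fin N)) (T : Set (Fin N)) : SimpleGraph (Fin (N + 1)) where
  Adj x y := Fin.cases (Fin.cases False (fun b => b ∈ T) y)
    (fun a => Fin.cases (a ∈ T) (fun b => G.Adj a b) y) x
  symm := ⟨fun x y => by
    cases x using Fin.cases <;> cases y using Fin.cases <;> simp [adj_comm]⟩
  loopless := ⟨fun x => by cases x using Fin.cases <;> simp⟩

/-- The splitting of the terms lifts to a splitting of the vertices, and the new vertex is joined to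
those that carry `s₁`. -/
theorem addVertex_mem {N : ℕ} {s₁ s₂ : Multiset ℕ} (h : s₁ + s₂ ∈ D₀ N) :
    s₁.card ::ₘ (s₁.map (· + 1) + s₂) ∈ D₀ (N + 1) := by
  classical
  obtain ⟨G, hG⟩ := h
  obtain ⟨M₁, M₂, hM, rfl, rfl⟩ := exists_split_of_map_eq_add _ _ _ _ hG
  have hnd : (M₁ + M₂).Nodup := hM ▸ Finset.univ.nodup
  rw [Multiset.nodup_add] at hnd
  refine ⟨addVertex G {x | x ∈ M₁}, ?_⟩
  rw [degrees_eq_cons _ 0 G (by ext x y; simp [addVertex])]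
  congr 1
  · rw [degree_eq_sum, Fin.sum_univ_succ]
    simp only [SimpleGraph.irrefl, if_false, zero_add, Multiset.card_map]
    rw [← Finset.card_filter, ← Multiset.toFinset_card_of_nodup hnd.1]
    congr 1
    ext x
    simp only [Finset.mem_filter, Finset.mem_univ, true_and, Multiset.mem_toFinset]
    exact Iff.rfl
  · rw [hM, Multiset.map_add, Multiset.map_map]
    congr 1
    · refine Multiset.map_congr rfl fun w hw => ?_
      simp only [Function.comp_apply]
      rw [if_pos (by simpa [addVertex] using hw)]
    · refine Multiset.map_congr rfl fun w hw => ?_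
      have : w ∉ M₁ := fun h => Multiset.disjoint_left.1 hnd.2.2 h hw
      rw [if_neg (by simpa [addVertex] using this), add_zero]

theorem cons_map_succ_mem {N : ℕ} {t : Multiset ℕ} (h : t ∈ D₀ N) :
    N ::ₘ t.map (· + 1) ∈ D₀ (N + 1) := by
  have := addVertex_mem (s₁ := t) (s₂ := 0) (by simpa using h)
  rwa [card_of_mem_D₀ h, add_zero] at this

theorem zero_cons_mem {N : ℕ} {t : Multiset ℕ} (h : t ∈ D₀ N) : 0 ::ₘ t ∈ D₀ (N + 1) := by
  simpa using addVertex_mem (s₁ := 0) (s₂ := t) (by simpa using h)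

theorem one_cons_cons_mem {N d : ℕ} {t : Multiset ℕ} (h : d ::ₘ t ∈ D₀ N) :
    1 ::ₘ (d + 1) ::ₘ t ∈ D₀ (N + 1) := by
  simpa using addVertex_mem (s₁ := {d}) (s₂ := t) (by simpa using h)

/-- Deleting a dominating vertex. -/
theorem exists_eq_cons_map_succ {N : ℕ} {s : Multiset ℕ} (h : s ∈ D₀ (N + 1)) (hN : N ∈ s) :
    ∃ t ∈ D₀ N, s = N ::ₘ t.map (· + 1) := by
  classical
  obtain ⟨G, rfl⟩ := h
  obtain ⟨v, hv⟩ := mem_degrees.1 hN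
  refine ⟨_, ⟨G.comap v.succAbove, rfl⟩, ?_⟩
  rw [degrees_eq_cons G v _ rfl, degrees, Multiset.map_map, hv]
  congr 1
  refine Multiset.map_congr rfl fun w _ => ?_
  have : G.Adj v (v.succAbove w) :=
    (degree_eq_card_sub_one G v).1 (by simpa using hv) (Fin.succAbove_ne v w).symm
  simp [this]

/-- Deleting an isolated vertex. -/
theorem exists_eq_zero_cons {N : ℕ} {s : Multiset ℕ} (h : s ∈ D₀ (N + 1)) (h0 : 0 ∈ s) :
    ∃ t ∈ D₀ N, s = 0 ::ₘ t := by
  classical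
  obtain ⟨G, rfl⟩ := h
  obtain ⟨v, hv⟩ := mem_degrees.1 h0
  refine ⟨_, ⟨G.comap v.succAbove, rfl⟩, ?_⟩
  rw [degrees_eq_cons G v _ rfl, degrees, hv]
  congr 1
  refine Multiset.map_congr rfl fun w _ => ?_
  have : ¬ G.Adj v (v.succAbove w) := fun h => by
    have := (G.degree_pos_iff_exists_adj v).2 ⟨_, h⟩
    omega
  simp [this]

theorem compl_mem {n : ℕ} {s : Multiset ℕ} (h : s ∈ D₀ n) :
    s.map (fun d => n - 1 - d) ∈ D₀ n := by
  classical
  obtain ⟨G, rfl⟩ := h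
  refine ⟨Gᶜ, ?_⟩
  rw [degrees, degrees, Multiset.map_map]
  refine Multiset.map_congr rfl fun w _ => ?_
  simp [degree_compl]

/-- Positive integers with an even sum that is small enough are the degrees of a forest. -/
theorem mem_D₀_of_sum_lt (N : ℕ) : ∀ t : Multiset ℕ, t.card = N → (∀ d ∈ t, 1 ≤ d) →
    Even t.sum → (t.sum < 2 * N ∨ N = 0) → t ∈ D₀ N := by
  induction N using Nat.strong_induction_on with
  | _ N ih =>
  -- The alternative `N = 0` in the last hypothesis lets the induction reach the empty sequence,
  -- where the strict bound fails.
  intro t hcard hpos heven hsum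
  rcases Nat.eq_zero_or_pos N with rfl | hN
  · obtain rfl := Multiset.card_eq_zero.1 hcard
    exact ⟨⊥, Multiset.card_eq_zero.1 (card_degrees _)⟩
  have hsum : t.sum < 2 * N := hsum.resolve_right hN.ne'
  by_cases hx : ∃ x ∈ t, 2 ≤ x
  · obtain ⟨x, hxt, hx⟩ := hx
    obtain ⟨r, rfl⟩ := Multiset.exists_cons_of_mem hxt
    -- The average term is below 2, so a leaf exists; it is removed from a vertex of degree `x ≥ 2`,
    -- which keeps all terms positive.
    have h1 : 1 ∈ r := by
      by_contra h1
      have : r.card • 2 ≤ r.sum := Multiset.card_nsmul_le_sum fun d hd => by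
        have := hpos d (Multiset.mem_cons_of_mem hd)
        have : d ≠ 1 := fun h => h1 (h ▸ hd)
        omega
      simp only [Multiset.card_cons, Multiset.sum_cons, smul_eq_mul] at *
      omega
    obtain ⟨q, rfl⟩ := Multiset.exists_cons_of_mem h1
    simp only [Multiset.card_cons, Multiset.sum_cons] at *
    obtain ⟨y, rfl⟩ : ∃ y, x = y + 1 := ⟨x - 1, by omega⟩
    obtain rfl : N = q.card + 1 + 1 := hcard.symm
    have := ih (q.card + 1) (by omega) (y ::ₘ q) (by simp) (fun d hd => by
      rcases Multiset.mem_cons.1 hd with rfl | hd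
      · omega
      · exact hpos d (by simp [hd])) (by
        rw [Multiset.sum_cons]
        rw [Nat.even_iff] at heven ⊢
        omega) (by rw [Multiset.sum_cons]; omega)
    have := one_cons_cons_mem this
    rwa [Multiset.cons_swap] at this
  · push Not at hx
    obtain rfl : t = Multiset.replicate N 1 := Multiset.eq_replicate.2 ⟨hcard, fun d hd => by
      have := hx d hd; have := hpos d hd; omega⟩
    simp only [Multiset.sum_replicate, smul_eq_mul, mul_one] at heven hsum
    obtain ⟨k, rfl⟩ : ∃ k, N = k + 2 := ⟨N - 2, by rw [Nat.even_iff] at heven; omega⟩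
    have := ih k (by omega) (Multiset.replicate k 1) (by simp)
      (fun d hd => (Multiset.eq_of_mem_replicate hd).ge) (by
        simp only [Multiset.sum_replicate, smul_eq_mul, mul_one]
        rw [Nat.even_iff] at heven ⊢; omega)
      (by simp only [Multiset.sum_replicate, smul_eq_mul, mul_one]; omega)
    -- An isolated vertex with a leaf attached is one more edge of the matching.
    simpa [Multiset.replicate_succ] using one_cons_cons_mem (zero_cons_mem this)

end Sequences

/-! ### Characterization of biconnected degree sequences. -/

section Biconnected

theorem reachable_induce_of_deleteIncidenceSet {V : Type*} {G : SimpleGraph V} {v : V}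
    {x y : V} (hx : x ∈ ({v}ᶜ : Set V)) (hy : y ∈ ({v}ᶜ : Set V))
    (h : (G.deleteIncidenceSet v).Reachable x y) :
    (G.induce {v}ᶜ).Reachable ⟨x, hx⟩ ⟨y, hy⟩ := by
  obtain ⟨w⟩ := h
  induction w with
  | nil => rfl
  | @cons x z y hxz w ih =>
    obtain ⟨h1, h2, h3⟩ := deleteIncidenceSet_adj.1 hxz
    exact (Adj.reachable (show (G.induce {v}ᶜ).Adj ⟨x, hx⟩ ⟨z, h3⟩ from h1)).trans (ih h3 hy)

-- Deleting the only neighbour of a vertex would cut it off from a third vertex.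
open Classical in
theorem Biconnected.two_le_degree {n : ℕ} (hn : 3 ≤ n) {G : SimpleGraph (Fin n)}
    (hG : Biconnected G) (x : Fin n) : 2 ≤ G.degree x := by
  have : Nontrivial (Fin n) := Fin.nontrivial_iff_two_le.2 (by omega)
  by_contra! hlt
  have h1 : 0 < G.degree x := hG.1.preconnected.degree_pos_of_nontrivial x
  obtain ⟨w, hw⟩ := (G.degree_pos_iff_exists_adj x).1 h1
  have huniq : ∀ z, G.Adj x z → z = w := by
    have : (G.neighborFinset x).card ≤ 1 := by rw [card_neighborFinset_eq_degree]; omega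
    intro z hz
    exact Finset.card_le_one.1 this z (by simpa using hz) w (by simpa using hw)
  obtain ⟨z, hz⟩ : ∃ z, z ∉ ({x, w} : Finset (Fin n)) := by
    by_contra! hall
    have := Finset.card_le_card (fun z _ => hall z : Finset.univ ⊆ ({x, w} : Finset (Fin n)))
    have h2 : ({x, w} : Finset (Fin n)).card ≤ 2 := Finset.card_le_two
    simp only [Finset.card_univ, Fintype.card_fin] at this
    omega
  simp only [Finset.mem_insert, Finset.mem_singleton, not_or] at hz
  obtain ⟨p⟩ := hG.2 w ⟨x, hw.ne⟩ ⟨z, hz.2⟩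
  cases p with
  | nil => exact hz.1 rfl
  | @cons _ q _ h _ => exact q.2 (huniq q.1 h)

/-- With `m` edges, `s.sum = 2 * m`, so the inequality says `m - i ≥ n - 2`: deleting a vertex of
degree `i` leaves enough edges for a spanning tree on the other `n - 1` vertices. -/
theorem mem_Db_iff {n : ℕ} (hn : 3 ≤ n) {s : Multiset ℕ} :
    s ∈ Db n ↔ s ∈ D₂ n ∧ ∀ i ∈ s, 2 * n + 2 * i ≤ s.sum + 4 := by
  classical
  constructor
  · rintro ⟨G, hG, rfl⟩
    have h2 : ∀ d ∈ degrees G, 2 ≤ d := fun d hd => by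
      obtain ⟨v, rfl⟩ := mem_degrees.1 hd
      exact hG.two_le_degree hn v
    refine ⟨⟨⟨⟨G, rfl⟩, fun d hd => (h2 d hd).trans' one_le_two⟩, h2⟩, fun i hi => ?_⟩
    obtain ⟨v, rfl⟩ := mem_degrees.1 hi
    have : Nontrivial (Fin n) := Fin.nontrivial_iff_two_le.2 (by omega)
    obtain ⟨y, hy⟩ := exists_ne v
    have hconn : (G.induce {v}ᶜ).Connected := 
      { preconnected := hG.2 v, nonempty := ⟨y, hy⟩ }
    have h3 := hconn.card_vert_le_card_edgeSet_add_one
    have h4 := card_edgeFinset_induce_compl_singleton G v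
    have h5 := card_edgeFinset_deleteIncidenceSet G v
    have h6 : Nat.card ({v}ᶜ : Set (Fin n)) = n - 1 := by
      rw [Nat.card_coe_set_eq, Set.ncard_compl]
      simp
    rw [sum_degrees]
    have h7 := G.degree_le_card_edgeFinset v
    simp only [edgeFinset_card, ← Nat.card_eq_fintype_card] at *
    omega
  · rintro ⟨⟨⟨⟨G₀, rfl⟩, -⟩, h2⟩, hsum⟩
    obtain ⟨G, hd, hr⟩ := exists_reachable_deleteIncidenceSet G₀
      (fun x => h2 _ (mem_degrees.2 ⟨x, rfl⟩)) (fun v => by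
        have := hsum _ (mem_degrees.2 ⟨v, rfl⟩)
        rw [sum_degrees] at this
        rw [Fintype.card_fin]
        omega)
    refine ⟨G, ⟨{ preconnected := fun x y => ?_, nonempty := ⟨0, by omega⟩ }, fun v x y => ?_⟩, ?_⟩
    -- Connectedness of `G` follows by deleting a third vertex, which exists as `n ≥ 3`.
    · obtain ⟨z, hz⟩ : ∃ z, z ∉ ({x, y} : Finset (Fin n)) := by
        by_contra! hall
        have := Finset.card_le_card (fun z _ => hall z : Finset.univ ⊆ ({x, y} : Finset (Fin n)))
        have h2 : ({x, y} : Finset (Fin n)).card ≤ 2 := Finset.card_le_two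
        simp only [Finset.card_univ, Fintype.card_fin] at this
        omega
      simp only [Finset.mem_insert, Finset.mem_singleton, not_or] at hz
      exact (hr z x y (Ne.symm hz.1) (Ne.symm hz.2)).mono (deleteIncidenceSet_le G z)
    · exact reachable_induce_of_deleteIncidenceSet x.2 y.2 (hr v x y x.2 y.2)
    · exact Multiset.map_congr rfl fun z _ => hd z

end Biconnected

/-! ### Counting sequences that contain a 1. -/

section Counting

theorem map_compl_map_compl {n : ℕ} {s : Multiset ℕ} (hs : s ∈ D₀ n) :
    (s.map fun d => n - 1 - d).map (fun d => n - 1 - d) = s := by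
  rw [Multiset.map_map]
  conv_rhs => rw [← Multiset.map_id s]
  refine Multiset.map_congr rfl fun d hd => ?_
  have := lt_of_mem_D₀ hs hd
  simp only [Function.comp_apply, id]
  omega

/-- Sequences with a term `1` and no dominating term correspond to `S n` by complementation. -/
theorem ncard_one_mem_of_not_mem {n : ℕ} (hn : 3 ≤ n) :
    {s | s ∈ D n ∧ 1 ∈ s ∧ n - 1 ∉ s}.ncard = (S n).ncard := by
  have himage : {s | s ∈ D n ∧ 1 ∈ s ∧ n - 1 ∉ s} =
      (fun s : Multiset ℕ => s.map fun d => n - 1 - d) '' S n := by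
    ext s
    constructor
    · rintro ⟨⟨h0, hpos⟩, h1, hdom⟩
      refine ⟨_, ⟨⟨compl_mem h0, fun d hd => ?_⟩, ?_, fun d hd => ?_⟩, map_compl_map_compl h0⟩
      · obtain ⟨e, he, rfl⟩ := Multiset.mem_map.1 hd
        have := lt_of_mem_D₀ h0 he
        have : e ≠ n - 1 := fun h => hdom (h ▸ he)
        omega
      · exact Multiset.mem_map.2 ⟨1, h1, by omega⟩
      · obtain ⟨e, he, rfl⟩ := Multiset.mem_map.1 hd
        have := hpos e he
        omega
    · rintro ⟨t, ⟨⟨h0, hpos⟩, hmem, hmax⟩, rfl⟩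
      refine ⟨⟨compl_mem h0, fun d hd => ?_⟩, Multiset.mem_map.2 ⟨n - 2, hmem, by omega⟩,
        fun hd => ?_⟩
      · obtain ⟨e, he, rfl⟩ := Multiset.mem_map.1 hd
        have : e ≤ n - 2 := hmax he
        omega
      · obtain ⟨e, he, h⟩ := Multiset.mem_map.1 hd
        have := hpos e he
        omega
  rw [himage]
  refine Set.InjOn.ncard_image fun s hs t ht h => ?_
  rw [← map_compl_map_compl hs.1.1, ← map_compl_map_compl ht.1.1]
  exact congrArg _ h

/-- Sequences with a term `1` and a dominating term correspond to sequences with two terms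
fewer. -/
theorem ncard_one_mem_of_mem {n : ℕ} (hn : 3 ≤ n) :
    {s | s ∈ D n ∧ 1 ∈ s ∧ n - 1 ∈ s}.ncard = (D₀ (n - 2)).ncard := by
  obtain ⟨N, rfl⟩ : ∃ N, n = N + 2 := ⟨n - 2, by omega⟩
  have himage : {s | s ∈ D (N + 2) ∧ 1 ∈ s ∧ N + 2 - 1 ∈ s} =
      (fun t : Multiset ℕ => (N + 1) ::ₘ 1 ::ₘ t.map (· + 1)) '' D₀ N := by
    ext s
    constructor
    · rintro ⟨⟨h0, -⟩, h1, hdom⟩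
      obtain ⟨t, ht, rfl⟩ := exists_eq_cons_map_succ h0 hdom
      have h0t : 0 ∈ t := by
        -- As `n ≥ 3`, the dominating term is not itself the 1.
        rcases Multiset.mem_cons.1 h1 with h | h
        · omega
        · obtain ⟨e, he, h⟩ := Multiset.mem_map.1 h
          obtain rfl : e = 0 := by omega
          exact he
      obtain ⟨u, hu, rfl⟩ := exists_eq_zero_cons ht h0t
      exact ⟨u, hu, by simp⟩
    · rintro ⟨t, ht, rfl⟩
      refine ⟨⟨?_, ?_⟩, by simp, by simp⟩
      · simpa using cons_map_succ_mem (zero_cons_mem ht)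
      · intro d hd
        simp only [Multiset.mem_cons, Multiset.mem_map] at hd
        omega
  rw [himage, Nat.add_sub_cancel]
  refine Set.ncard_image_of_injective _ fun s t h => ?_
  simp only [Multiset.cons_inj_right] at h
  exact Multiset.map_injective (add_left_injective 1) h

theorem ncard_D_eq {n : ℕ} (hn : 3 ≤ n) :
    (D n).ncard = (D₂ n).ncard + ((D₀ (n - 2)).ncard + (S n).ncard) := by
  have hfin := (finite_sets n).2.1
  rw [← ncard_one_mem_of_mem hn, ← ncard_one_mem_of_not_mem hn,
    ← Set.ncard_union_eq _ (hfin.subset fun s h => h.1) (hfin.subset fun s h => h.1),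
    ← Set.ncard_union_eq _ (hfin.subset fun s h => h.1)
      (hfin.subset (Set.union_subset (fun s h => h.1) fun s h => h.1))]
  · congr 1
    ext s
    constructor
    · intro hs
      by_cases h1 : 1 ∈ s
      · by_cases h2 : n - 1 ∈ s
        · exact .inr (.inl ⟨hs, h1, h2⟩)
        · exact .inr (.inr ⟨hs, h1, h2⟩)
      · refine .inl ⟨hs, fun d hd => ?_⟩
        have := hs.2 d hd
        have : d ≠ 1 := fun h => h1 (h ▸ hd)
        omega
    · rintro (h | h | h) <;> exact h.1
  · rw [Set.disjoint_left]
    rintro s hs (h | h) <;> exact absurd (hs.2 1 h.2.1) (by omega)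
  · rw [Set.disjoint_left]
    exact fun s hs ht => ht.2.2 hs.2.2

/-! ### Counting the sequences in `D₂ n` that are not biconnected. -/

/-- The sequence with a term `i` whose other `n - 1` terms, reduced by `2`, are the terms of `q`,
padded by zeros. -/
def hubSeq (n i : ℕ) (q : Multiset ℕ) : Multiset ℕ :=
  i ::ₘ (q + Multiset.replicate (n - 1 - q.card) 0).map (· + 2)

theorem card_parts_le {j : ℕ} (π : Nat.Partition j) : π.parts.card ≤ j := by
  have : π.parts.card • 1 ≤ π.parts.sum := Multiset.card_nsmul_le_sum fun d hd => π.parts_pos hd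
  rw [π.parts_sum] at this
  simpa using this

theorem sum_map_add (s : Multiset ℕ) (k : ℕ) : (s.map (· + k)).sum = s.sum + k * s.card := by
  rw [Multiset.sum_map_add]
  simp [mul_comm]

theorem sum_hubSeq {n i j : ℕ} (π : Nat.Partition j) (hj : j ≤ n - 1) :
    (hubSeq n i π.parts).sum = i + (j + 2 * (n - 1)) := by
  have := card_parts_le π
  rw [hubSeq, Multiset.sum_cons, sum_map_add]
  simp only [Multiset.sum_add, π.parts_sum, Multiset.sum_replicate, Multiset.card_add,
    Multiset.card_replicate, smul_zero, add_zero]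
  congr 3
  omega

/-- Removing the hub lowers its `i` neighbours by 1, chosen to include all parts of `π`; the other
`n - 1 - i` terms are 2. The remaining sum `j + i + 2 * (n - 1 - i)` is below `2 * (n - 1)` since `j
< i`, so `mem_D₀_of_sum_lt` applies. -/
theorem hubSeq_mem_D₀ {n i j : ℕ} (π : Nat.Partition j) (hi : i < n) (hj : j + 4 ≤ i)
    (hpar : j % 2 = i % 2) : hubSeq n i π.parts ∈ D₀ n := by
  have hc := card_parts_le π
  set q₁ := (π.parts + Multiset.replicate (i - π.parts.card) 0) with hq₁
  have hq₁c : q₁.card = i := by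
    rw [hq₁, Multiset.card_add, Multiset.card_replicate]; omega
  have hq₁s : q₁.sum = j := by simp [hq₁, π.parts_sum]
  have hforest : q₁.map (· + 1) + Multiset.replicate (n - 1 - i) 2 ∈ D₀ (n - 1) := by
    refine mem_D₀_of_sum_lt _ _ ?_ ?_ ?_ ?_
    · rw [Multiset.card_add, Multiset.card_map, Multiset.card_replicate]; omega
    · intro d hd
      rcases Multiset.mem_add.1 hd with h | h
      · obtain ⟨e, -, rfl⟩ := Multiset.mem_map.1 h
        omega
      · rw [Multiset.eq_of_mem_replicate h]; omega
    · rw [Multiset.sum_add, sum_map_add, Multiset.sum_replicate, hq₁c, hq₁s, Nat.even_iff,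
        smul_eq_mul]
      omega
    · rw [Multiset.sum_add, sum_map_add, Multiset.sum_replicate, hq₁c, hq₁s, smul_eq_mul]
      omega
  have := addVertex_mem hforest
  rw [Multiset.card_map, hq₁c, Nat.sub_add_cancel (by omega), Multiset.map_map] at this
  convert this using 1
  have hsplit : n - 1 - π.parts.card = (i - π.parts.card) + (n - 1 - i) := by omega
  rw [hubSeq, hsplit, Multiset.replicate_add, ← add_assoc, ← hq₁, Multiset.map_add,
    Multiset.map_replicate]
  rfl

theorem mem_hubSeq {n i j d : ℕ} {π : Nat.Partition j} (hd : d ∈ hubSeq n i π.parts) :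
    d = i ∨ (2 ≤ d ∧ d ≤ j + 2) := by
  rcases Multiset.mem_cons.1 hd with rfl | hd
  · exact .inl rfl
  · obtain ⟨e, he, rfl⟩ := Multiset.mem_map.1 hd
    right
    rcases Multiset.mem_add.1 he with he | he
    · have := Multiset.le_sum_of_mem he
      rw [π.parts_sum] at this
      omega
    · rw [Multiset.eq_of_mem_replicate he]; omega

/-- All terms but the hub are at most `j + 2 < i`, so the hub is the unique largest term; the parts
are then recovered by discarding the padding zeros. -/
theorem hubSeq_injective {n i i' j j' : ℕ} {π : Nat.Partition j} {π' : Nat.Partition j'}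
    (hj : j + 4 ≤ i) (hj' : j' + 4 ≤ i') (h : hubSeq n i π.parts = hubSeq n i' π'.parts) :
    i = i' ∧ π.parts = π'.parts := by
  have h1 := mem_hubSeq (h ▸ Multiset.mem_cons_self i _ : i ∈ hubSeq n i' π'.parts)
  have h2 := mem_hubSeq (h ▸ Multiset.mem_cons_self i' _ : i' ∈ hubSeq n i π.parts)
  obtain rfl : i = i' := by omega
  refine ⟨rfl, ?_⟩
  rw [hubSeq, hubSeq, Multiset.cons_inj_right] at h
  have h3 := congrArg (Multiset.filter (0 < ·)) (Multiset.map_injective (add_left_injective 2) h)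
  have hpos : ∀ {k : ℕ} (π : Nat.Partition k), π.parts.filter (0 < ·) = π.parts := fun π =>
    Multiset.filter_eq_self.2 fun d hd => π.parts_pos hd
  have hzero : ∀ k : ℕ, (Multiset.replicate k 0).filter (0 < ·) = 0 := fun k =>
    Multiset.filter_eq_nil.2 fun d hd => by rw [Multiset.eq_of_mem_replicate hd]; simp
  simpa only [Multiset.filter_add, hpos, hzero, add_zero] using h3

/-- The admissible sums of the other terms, reduced by `2`, when the largest term is `i`. -/
def excess (i : ℕ) : Finset ℕ := (Finset.range (i - 3)).filter fun j => j % 2 = i % 2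

/-- The hub sequences, indexed by their largest term and a partition. -/
def hubIndex (n : ℕ) : Finset (Σ _ : ℕ, Σ j : ℕ, Nat.Partition j) :=
  (Finset.Icc 4 (n - 1)).sigma fun i => (excess i).sigma fun _ => Finset.univ

/-- The bound `4 ≤ x.1` is implied by `x.2.1 + 4 ≤ x.1`. -/
theorem mem_hubIndex {n : ℕ} {x : Σ _ : ℕ, Σ j : ℕ, Nat.Partition j} :
    x ∈ hubIndex n ↔ x.1 ≤ n - 1 ∧ x.2.1 + 4 ≤ x.1 ∧ x.2.1 % 2 = x.1 % 2 := by
  simp only [hubIndex, excess, Finset.mem_sigma, Finset.mem_Icc, Finset.mem_filter,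
    Finset.mem_range, Finset.mem_univ, and_true]
  omega

theorem D₂_diff_Db {n : ℕ} (hn : 5 ≤ n) :
    D₂ n \ Db n = (fun x : Σ _ : ℕ, Σ j : ℕ, Nat.Partition j => hubSeq n x.1 x.2.2.parts) ''
      (hubIndex n : Set (Σ _ : ℕ, Σ j : ℕ, Nat.Partition j)) := by
  ext s
  constructor
  · rintro ⟨hs, hb⟩
    rw [mem_Db_iff (by omega)] at hb
    obtain ⟨i, hi, hsum⟩ : ∃ i ∈ s, s.sum + 4 < 2 * n + 2 * i := by
      by_contra! hcon
      exact hb ⟨hs, hcon⟩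
    have hlt := lt_of_mem_D₀ hs.1.1 hi
    have heven := Nat.even_iff.1 (even_sum_of_mem_D₀ hs.1.1)
    have hcard := card_of_mem_D₀ hs.1.1
    obtain ⟨r, rfl⟩ := Multiset.exists_cons_of_mem hi
    obtain ⟨q, rfl⟩ : ∃ q : Multiset ℕ, r = q.map (· + 2) := ⟨r.map (· - 2), by
      rw [Multiset.map_map]
      conv_lhs => rw [← Multiset.map_id r]
      refine Multiset.map_congr rfl fun d hd => ?_
      have := hs.2 d (Multiset.mem_cons_of_mem hd)
      simp only [Function.comp_apply, id]
      omega⟩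
    rw [Multiset.sum_cons, sum_map_add] at hsum heven
    rw [Multiset.card_cons, Multiset.card_map] at hcard
    refine ⟨⟨i, q.sum, Nat.Partition.ofMultiset q⟩, ?_, ?_⟩
    -- The violated inequality reads `q.sum + 2 < i`; evenness of the total gives `q.sum` the parity
    -- of `i`, which improves this to `q.sum + 4 ≤ i`.
    · rw [Finset.mem_coe, mem_hubIndex]
      dsimp only
      omega
    · simp only [hubSeq, Nat.Partition.ofMultiset_parts]
      congr 2
      -- `Nat.Partition.ofMultiset` drops the zeros of `q`; by cardinality these are exactly the
      -- padding in `hubSeq`.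
      have hz : q.filter (fun d => ¬ d ≠ 0) =
          Multiset.replicate (n - 1 - (q.filter (· ≠ 0)).card) 0 := by
        rw [Multiset.eq_replicate]
        refine ⟨?_, fun d hd => by simpa using (Multiset.mem_filter.1 hd).2⟩
        have := congrArg Multiset.card (Multiset.filter_add_not (· ≠ 0) q)
        rw [Multiset.card_add] at this
        omega
      rw [← hz, Multiset.filter_add_not]
  · rintro ⟨⟨i, j, π⟩, hx, rfl⟩
    rw [Finset.mem_coe, mem_hubIndex] at hx
    dsimp only at hx ⊢
    have h2 : ∀ d ∈ hubSeq n i π.parts, 2 ≤ d := fun d hd => by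
      have := mem_hubSeq hd
      omega
    refine ⟨⟨⟨hubSeq_mem_D₀ π (by omega) hx.2.1 hx.2.2, fun d hd => by have := h2 d hd; omega⟩,
      h2⟩, fun hb => ?_⟩
    rw [mem_Db_iff (by omega)] at hb
    have := hb.2 i (Multiset.mem_cons_self _ _)
    rw [sum_hubSeq π (by omega)] at this
    omega

theorem ncard_D₂_diff_Db {n : ℕ} (hn : 5 ≤ n) :
    (D₂ n \ Db n).ncard = ∑ i ∈ Finset.Icc 4 (n - 1), ∑ j ∈ excess i, p j := by
  rw [D₂_diff_Db hn, Set.InjOn.ncard_image, Set.ncard_coe_finset, hubIndex,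
    Finset.card_sigma]
  · refine Finset.sum_congr rfl fun i _ => ?_
    rw [Finset.card_sigma]
    rfl
  · rintro ⟨i, j, π⟩ hx ⟨i', j', π'⟩ hx' h
    rw [Finset.mem_coe, mem_hubIndex] at hx hx'
    obtain ⟨rfl, hπ⟩ := hubSeq_injective hx.2.1 hx'.2.1 h
    obtain rfl : j = j' := by rw [← π.parts_sum, ← π'.parts_sum, hπ]
    obtain rfl : π = π' := Nat.Partition.ext hπ
    rfl

end Counting

end DegSeq

theorem mainTheorem8 (n : ℕ) (hn : 5 ≤ n) :
    ((DegSeq.D₂ n).ncard : ℤ) =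
        (DegSeq.D n).ncard - (DegSeq.D₀ (n - 2)).ncard - (DegSeq.S n).ncard ∧
    ((DegSeq.Db n).ncard : ℤ) =
        (DegSeq.D₂ n).ncard -
          ∑ i ∈ Finset.Icc 4 (n - 1),
            if Even i then ∑ j ∈ Finset.Icc 0 (i - 4) with Even j, (DegSeq.p j : ℤ)
            else ∑ j ∈ Finset.Icc 1 (i - 4) with Odd j, (DegSeq.p j : ℤ) := by
  constructor
  · rw [DegSeq.ncard_D_eq (by omega)]
    push_cast
    ring
  · have hsub : DegSeq.Db n ⊆ DegSeq.D₂ n := fun s hs =>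
      ((DegSeq.mem_Db_iff (by omega)).1 hs).1
    have h1 := Set.ncard_sdiff_add_ncard_of_subset hsub (DegSeq.finite_sets n).2.2.1
    have h2 : ∑ i ∈ Finset.Icc 4 (n - 1),
        (if Even i then ∑ j ∈ Finset.Icc 0 (i - 4) with Even j, (DegSeq.p j : ℤ)
          else ∑ j ∈ Finset.Icc 1 (i - 4) with Odd j, (DegSeq.p j : ℤ)) =
        ((DegSeq.D₂ n \ DegSeq.Db n).ncard : ℤ) := by
      rw [DegSeq.ncard_D₂_diff_Db hn]
      push_cast
      refine Finset.sum_congr rfl fun i hi => ?_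
      rw [Finset.mem_Icc] at hi
      split_ifs with he
      · refine Finset.sum_congr ?_ fun _ _ => rfl
        ext j
        simp only [DegSeq.excess, Finset.mem_filter, Finset.mem_Icc, Finset.mem_range,
          Nat.even_iff] at he ⊢
        omega
      · refine Finset.sum_congr ?_ fun _ _ => rfl
        ext j
        simp only [DegSeq.excess, Finset.mem_filter, Finset.mem_Icc, Finset.mem_range,
          Nat.even_iff, Nat.odd_iff] at he ⊢
        omega
    rw [h2]
    omega
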